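/- A polyhedron in $\mathbb{R}^d$ is a set of the form $\{x\in\mathbb{R}^d : Ax\le b\}$ with finitely many inequalities; a polytope is a nonempty bounded polyhedron. A face of a polytope $Q$ is the set of maximizers over $Q$ of a linear function, and a facet is a face of dimension $\dim Q-1$, where the dimension is that of the affine hull; $h(Q)$ denotes the number of facets of $Q$. The extension complexity of a polytope $P\subseteq\mathbb{R}^d$ is $$\mathrm{xc}(P)=\min\{h(Q) : Q\subseteq\mathbb{R}^e \text{ a polytope},\ e\ge d,\ \pi(Q)=P \text{ for some affine map } \pi:\mathbb{R}^e\to\mathbb{R}^d\},$$ and its virtual extension complexity is $$\mathrm{vxc}(P)=\min\{\mathrm{xc}(Q)+\mathrm{xc}(R) : Q,R\subseteq\mathbb{R}^d \text{ polytopes with } P+Q=R\},$$ where $P+Q$ is the Minkowski sum. The support function of $P$ is $f_P:\mathbb{R}^d\to\mathbb{R}$, $f_P(c)=\max_{x\in P}c^\top x$. A rank-$2$ maxout network with $d$ inputs is a finite directed acyclic graph whose nodes of in-degree zero are exactly $d$ input neurons; the other nodes are called maxout units, and exactly one of them, the output neuron, has out-degree zero. Each arc $(u,v)$ carries two real weights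 $w^1_{uv},w^2_{uv}$. On input $x\in\mathbb{R}^d$ the $i$-th input neuron has value $x_i$, and each maxout unit $v$ has value $z_v=\max_{i\in\{1,2\}}\sum_{u} w^i_{uv}z_u$, the sum being over the in-neighbors $u$ of $v$. The network represents the function $\mathbb{R}^d\to\mathbb{R}$ that maps $x$ to the value of the output neuron, and its size is the number of maxout units. The neural network complexity $\mathrm{nnc}(P)$ is the minimum size of a rank-$2$ maxout network that represents $f_P$. **Theorem.** For every polytope $P$, $\mathrm{vxc}(P)\le 4\cdot\mathrm{nnc}(P)$. -/

import Mathlib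

open scoped Pointwise

noncomputable section

/-! ### Polyhedra and polytopes in `ℝ^d` -/

/-- A polyhedron: a finite intersection of halfspaces `{x | A x ≤ b}`. -/
def IsPolyhedron {d : ℕ} (P : Set (Fin d → ℝ)) : Prop :=
  ∃ (m : ℕ) (A : Matrix (Fin m) (Fin d) ℝ) (b : Fin m → ℝ), P = {x | A.mulVec x ≤ b}

/-- A polytope: a bounded polyhedron. Polytopes are nonempty, so that the support function is
defined and Minkowski addition of polytopes is cancellative. -/
structure IsPolytope {d : ℕ} (P : Set (Fin d → ℝ)) : Prop where
  isPolyhedron : IsPolyhedron P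
  isBounded : Bornology.IsBounded P
  nonempty : P.Nonempty

/-- The dimension of the affine hull of `P` (only used for nonempty `P`). -/
def polyDim {d : ℕ} (P : Set (Fin d → ℝ)) : ℕ :=
  Module.finrank ℝ (affineSpan ℝ P).direction

/-- A face of `P`: the set of maximizers over `P` of a linear objective function. -/
def IsFace {d : ℕ} (P F : Set (Fin d → ℝ)) : Prop :=
  ∃ c : Fin d → ℝ, F = {x | x ∈ P ∧ ∀ y ∈ P, c ⬝ᵥ y ≤ c ⬝ᵥ x}

/-- A facet of `P`: a face of dimension `dim P - 1`. (The empty set has dimension `-1` and is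
never a facet of a polytope, since faces of a polytope are nonempty.) -/
def IsFacet {d : ℕ} (P F : Set (Fin d → ℝ)) : Prop :=
  IsFace P F ∧ F.Nonempty ∧ polyDim F + 1 = polyDim P

/-- The number of facets of `P`. -/
def numFacets {d : ℕ} (P : Set (Fin d → ℝ)) : ℕ∞ :=
  {F : Set (Fin d → ℝ) | IsFacet P F}.encard

/-- `Q ⊆ ℝ^e`, together with the affine map `π : ℝ^e → ℝ^d`, is an extended formulation of
`P ⊆ ℝ^d`. -/
def IsExtendedFormulation {d e : ℕ} (P : Set (Fin d → ℝ)) (Q : Set (Fin e → ℝ))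
    (π : (Fin e → ℝ) →ᵃ[ℝ] (Fin d → ℝ)) : Prop :=
  d ≤ e ∧ IsPolytope Q ∧ π '' Q = P

/-- Extension complexity: the minimum number of facets of an extended formulation of `P`. -/
def xc {d : ℕ} (P : Set (Fin d → ℝ)) : ℕ∞ :=
  ⨅ (e : ℕ) (Q : Set (Fin e → ℝ)) (π : (Fin e → ℝ) →ᵃ[ℝ] (Fin d → ℝ))
    (_ : IsExtendedFormulation P Q π), numFacets Q

/-- Virtual extension complexity: the minimum of `xc Q + xc R` over polytopes `Q`, `R` whose
formal Minkowski difference is `P`, i.e. `P + Q = R`. -/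
def vxc {d : ℕ} (P : Set (Fin d → ℝ)) : ℕ∞ :=
  ⨅ (Q : Set (Fin d → ℝ)) (R : Set (Fin d → ℝ))
    (_ : IsPolytope Q ∧ IsPolytope R ∧ P + Q = R), xc Q + xc R

/-- The support function `c ↦ max_{x ∈ P} cᵀx` of a polytope. -/
def supportFn {d : ℕ} (P : Set (Fin d → ℝ)) (c : Fin d → ℝ) : ℝ :=
  sSup ((fun x => c ⬝ᵥ x) '' P)

/-! ### Maxout networks -/

/-- A maxout network of rank `k` with `d` input neurons and `s` maxout units. The node set is
`Fin d ⊕ Fin s`: input neurons on the left, maxout units on the right. -/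
structure MaxoutNetwork (k d s : ℕ) where
  /-- The arcs of the underlying directed graph. -/
  Arc : Fin d ⊕ Fin s → Fin d ⊕ Fin s → Prop
  /-- The graph is acyclic. -/
  acyclic : ∀ v, ¬ Relation.TransGen Arc v v
  /-- The input neurons are exactly the neurons with in-degree zero. -/
  inDegree_zero : ∀ v, (∀ u, ¬ Arc u v) ↔ ∃ i : Fin d, v = Sum.inl i
  /-- The output neuron. -/
  output : Fin s
  /-- The output neuron is the only maxout unit with out-degree zero. -/
  outDegree_zero : ∀ v : Fin s, (∀ u, ¬ Arc (Sum.inr v) u) ↔ v = output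
  /-- `weight i u v` is the `i`-th weight of the arc from `u` to `v`; the values at pairs that
  are not arcs are irrelevant. -/
  weight : Fin k → Fin d ⊕ Fin s → Fin d ⊕ Fin s → ℝ

namespace MaxoutNetwork

variable {k d s : ℕ} (N : MaxoutNetwork k d s)

theorem wellFounded_arc : WellFounded N.Arc := by
  have h : WellFounded (Relation.TransGen N.Arc) := by
    have : Std.Irrefl (Relation.TransGen N.Arc) := ⟨N.acyclic⟩
    exact Finite.wellFounded_of_trans_of_irrefl _
  exact Subrelation.wf (fun h => Relation.TransGen.single h) h

open Classical in
/-- The output `z_v(x)` of each neuron `v` on input `x`, by recursion along the acyclic graph: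
input neurons return the coordinates of `x`, and a maxout unit returns the maximum over
`i = 1, …, k` of the `i`-th weighted sum of the outputs of its in-neighbors. -/
def value (x : Fin d → ℝ) : Fin d ⊕ Fin s → ℝ :=
  N.wellFounded_arc.fix fun v z =>
    match v, z with
    | Sum.inl i, _ => x i
    | Sum.inr v, z => ⨆ i : Fin k, ∑ u : {u // N.Arc u (Sum.inr v)},
        N.weight i u (Sum.inr v) * z u u.2

theorem value_inl (x : Fin d → ℝ) (i : Fin d) : N.value x (Sum.inl i) = x i := by
  rw [value, WellFounded.fix_eq]

open Classical in
theorem value_inr (x : Fin d → ℝ) (v : Fin s) :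
    N.value x (Sum.inr v) = ⨆ i : Fin k, ∑ u : {u // N.Arc u (Sum.inr v)},
      N.weight i u (Sum.inr v) * N.value x u := by
  rw [value, WellFounded.fix_eq]

/-- The function `ℝ^d → ℝ` represented by the network. -/
def toFun (x : Fin d → ℝ) : ℝ := N.value x (Sum.inr N.output)

end MaxoutNetwork

/-- Neural network complexity: the minimum number of maxout units of a rank-2 maxout network
that represents the support function of `P`. -/
def nnc {d : ℕ} (P : Set (Fin d → ℝ)) : ℕ∞ :=
  ⨅ (s : ℕ) (N : MaxoutNetwork 2 d s) (_ : N.toFun = supportFn P), (s : ℕ∞)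

end

open scoped Pointwise

/-! ### Polyhedra -/

/-! Write the value of each unit as `z v = p v - n v` and split the weights into positive and
negative parts. Each of the two arguments of the maximum becomes a minuend minus a subtrahend, both
nonnegative combinations of earlier `p u` and `n u` (plus a linear function of the input). Let `n v`
be the sum of both subtrahends. Adding it to an argument cancels that argument's own subtrahend and
leaves the other one, so `p v` is a maximum of two combinations with nonnegative coefficients.
Unrolling the `n u` leaves a monotone system in the `p u` alone, and `n v` itself is a nonnegative
combination of the `p u`.

For such a system, `∑ l v * p v c` with `l ≥ 0` is the optimal value of a linear program (minimize
over all solutions of the inequalities defining the maxima). Its dual has two nonnegative variables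
and one equation per unit, and `c` enters only the objective. Hence one dual feasible set, projected
linearly to `ℝ^d`, is a polytope with this support function, and it has an extended formulation with
`2 * s` inequalities: `exists_polytope_of_monotone_system`. Facets are counted by
`numFacets_le_card`; Fourier–Motzkin elimination shows that the projection is a polyhedron.

Applied to `n` and `p` at the output, this gives `Q` and `R` with `f_P + f_Q = f_R`, hence `P + Q =
R`, at cost `2 * s + 2 * s`. -/

theorem isPolyhedron_setOf_forall_le {d : ℕ} {ι : Type} [Fintype ι] (A : ι → Fin d → ℝ)
    (b : ι → ℝ) : IsPolyhedron {x | ∀ i, A i ⬝ᵥ x ≤ b i} := by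
  let e := Fintype.equivFin ι
  refine ⟨Fintype.card ι, Matrix.of fun k => A (e.symm k), fun k => b (e.symm k), ?_⟩
  ext x
  constructor
  · intro h k
    exact h (e.symm k)
  · intro h i
    have := h (e i)
    simpa [Matrix.mulVec] using this

/-- Elimination of one real variable from a finite system of linear inequalities. -/
theorem exists_forall_mul_le {ι : Type} [Fintype ι] (β γ : ι → ℝ)
    (h₀ : ∀ i, β i = 0 → 0 ≤ γ i)
    (h : ∀ i j, 0 < β i → β j < 0 → 0 ≤ β i * γ j - β j * γ i) :
    ∃ t, ∀ i, β i * t ≤ γ i := by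
  classical
  have key : ∀ i j, 0 < β i → β j < 0 → γ j / β j ≤ γ i / β i := by
    intro i j hi hj
    rw [div_le_iff_of_neg hj, div_mul_eq_mul_div, div_le_iff₀ hi]
    linarith [h i j hi hj]
  suffices H : ∃ t, (∀ i, 0 < β i → t ≤ γ i / β i) ∧ ∀ j, β j < 0 → γ j / β j ≤ t by
    obtain ⟨t, h₁, h₂⟩ := H
    refine ⟨t, fun i => ?_⟩
    rcases lt_trichotomy (β i) 0 with hi | hi | hi
    · have := h₂ i hi
      rw [div_le_iff_of_neg hi] at this
      linarith
    · simpa [hi] using h₀ i hi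
    · have := h₁ i hi
      rw [le_div_iff₀ hi] at this
      linarith
  -- Take the largest lower bound; without lower bounds, the smallest upper bound; without either,
  -- any number.
  by_cases hn : (Finset.univ.filter fun j => β j < 0).Nonempty
  · refine ⟨(Finset.univ.filter fun j => β j < 0).sup' hn fun j => γ j / β j, ?_, ?_⟩
    · intro i hi
      refine Finset.sup'_le _ _ fun j hj => key i j hi (by simpa using hj)
    · intro j hj
      exact Finset.le_sup' (fun j => γ j / β j) (by simpa using hj)
  · have hn' : ∀ j, ¬ β j < 0 := fun j hj => hn ⟨j, by simpa using hj⟩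
    by_cases hp : (Finset.univ.filter fun i => 0 < β i).Nonempty
    · refine ⟨(Finset.univ.filter fun i => 0 < β i).inf' hp fun i => γ i / β i, ?_, ?_⟩
      · intro i hi
        exact Finset.inf'_le (fun i => γ i / β i) (by simpa using hi)
      · intro j hj
        exact absurd hj (hn' j)
    · exact ⟨0, fun i hi => absurd ⟨i, by simpa using hi⟩ hp, fun j hj => absurd hj (hn' j)⟩

/-- Fourier–Motzkin elimination: coordinate projections of polyhedra are polyhedra. -/
theorem isPolyhedron_setOf_exists_fin {d : ℕ} (m : ℕ) : ∀ {ι : Type} [Fintype ι]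
    (A : ι → Fin d → ℝ) (B : ι → Fin m → ℝ) (b : ι → ℝ),
    IsPolyhedron {x | ∃ y : Fin m → ℝ, ∀ i, A i ⬝ᵥ x + B i ⬝ᵥ y ≤ b i} := by
  classical
  induction m with
  | zero =>
    intro ι _ A B b
    convert isPolyhedron_setOf_forall_le A b using 1
    ext x
    simp [dotProduct]
  | succ m ih =>
    intro ι _ A B b
    let β : ι → ℝ := fun i => B i 0
    let B' : ι → Fin m → ℝ := fun i => Fin.tail (B i)
    -- One new inequality for each old one free of the eliminated variable, and one for each pair of
    -- opposite signs, combined with positive multipliers so that the variable cancels.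
    let κ := {i // β i = 0} ⊕ ({i // 0 < β i} × {j // β j < 0})
    let A₁ : κ → Fin d → ℝ := Sum.elim (fun i => A i)
      (fun q => β q.1 • A q.2 - β q.2 • A q.1)
    let B₁ : κ → Fin m → ℝ := Sum.elim (fun i => B' i)
      (fun q => β q.1 • B' q.2 - β q.2 • B' q.1)
    let b₁ : κ → ℝ := Sum.elim (fun i => b i) (fun q => β q.1 * b q.2 - β q.2 * b q.1)
    convert ih A₁ B₁ b₁ using 1
    have hB : ∀ i (y : Fin (m + 1) → ℝ), B i ⬝ᵥ y = β i * y 0 + B' i ⬝ᵥ Fin.tail y := by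
      intro i y
      simp [dotProduct, Fin.sum_univ_succ, β, B', Fin.tail]
    ext x
    constructor
    · rintro ⟨y, hy⟩
      refine ⟨Fin.tail y, ?_⟩
      rintro (⟨i, hi⟩ | ⟨⟨i, hi⟩, ⟨j, hj⟩⟩)
      · have := hy i
        rw [hB, hi] at this
        simpa [A₁, B₁, b₁] using this
      · have h₁ := hy i
        have h₂ := hy j
        rw [hB] at h₁ h₂
        simp only [A₁, B₁, b₁, Sum.elim_inr, sub_dotProduct, smul_dotProduct, smul_eq_mul]
        nlinarith [mul_le_mul_of_nonneg_left h₂ hi.le,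
          mul_le_mul_of_nonneg_left h₁ (neg_nonneg.2 hj.le)]
    · rintro ⟨y, hy⟩
      obtain ⟨t, ht⟩ := exists_forall_mul_le β (fun i => b i - A i ⬝ᵥ x - B' i ⬝ᵥ y)
        (fun i hi => by
          have := hy (Sum.inl ⟨i, hi⟩)
          simp only [A₁, B₁, b₁, Sum.elim_inl] at this
          linarith)
        (fun i j hi hj => by
          have := hy (Sum.inr ⟨⟨i, hi⟩, ⟨j, hj⟩⟩)
          simp only [A₁, B₁, b₁, Sum.elim_inr, sub_dotProduct, smul_dotProduct,
            smul_eq_mul] at this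
          linarith)
      refine ⟨Fin.cons t y, fun i => ?_⟩
      rw [hB, Fin.cons_zero, Fin.tail_cons]
      linarith [ht i]

theorem isPolyhedron_setOf_exists {d : ℕ} {ι κ : Type} [Fintype ι] [Fintype κ]
    (A : κ → Fin d → ℝ) (B : κ → ι → ℝ) (b : κ → ℝ) :
    IsPolyhedron {x | ∃ y : ι → ℝ, ∀ k, A k ⬝ᵥ x + B k ⬝ᵥ y ≤ b k} := by
  let e := Fintype.equivFin ι
  convert isPolyhedron_setOf_exists_fin (Fintype.card ι) A (fun k => B k ∘ e.symm) b using 1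
  ext x
  constructor
  · rintro ⟨y, hy⟩
    refine ⟨y ∘ e.symm, fun k => ?_⟩
    rw [comp_equiv_dotProduct_comp_equiv]
    exact hy k
  · rintro ⟨y, hy⟩
    refine ⟨y ∘ e, fun k => ?_⟩
    have h := hy k
    rwa [comp_equiv_symm_dotProduct] at h

/-- The linear image of a set given by nonnegativity constraints and linear equations is a
polyhedron. -/
theorem isPolyhedron_image_standardForm {d : ℕ} {ι κ : Type} [Fintype ι] [Fintype κ]
    (E : κ → ι → ℝ) (q : κ → ℝ) (M : Fin d → ι → ℝ) :
    IsPolyhedron ((fun y : ι → ℝ => fun j => M j ⬝ᵥ y) ''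
      {y | (∀ i, 0 ≤ y i) ∧ ∀ k, E k ⬝ᵥ y = q k}) := by
  classical
  let J := ι ⊕ (κ ⊕ κ) ⊕ (Fin d ⊕ Fin d)
  let A : J → Fin d → ℝ := Sum.elim 0 (Sum.elim 0
    (Sum.elim (fun j => Pi.single j 1) (fun j => -Pi.single j 1)))
  let B : J → ι → ℝ := Sum.elim (fun i => -Pi.single i 1)
    (Sum.elim (Sum.elim E (-E)) (Sum.elim (-M) M))
  let c : J → ℝ := Sum.elim 0 (Sum.elim (Sum.elim q (-q)) 0)
  convert isPolyhedron_setOf_exists A B c using 1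
  ext x
  simp only [Set.mem_image, Set.mem_ofPred_eq]
  refine exists_congr fun y => ?_
  simp only [J, A, B, c, Sum.forall, Sum.elim_inl, Sum.elim_inr, Pi.zero_apply, Pi.neg_apply,
    zero_dotProduct, neg_dotProduct, single_one_dotProduct, zero_add, funext_iff]
  constructor
  · rintro ⟨⟨h₁, h₂⟩, h₃⟩
    refine ⟨fun i => by linarith [h₁ i], ⟨fun k => (h₂ k).le, fun k => by linarith [h₂ k]⟩,
      fun j => by linarith [h₃ j], fun j => by linarith [h₃ j]⟩
  · rintro ⟨h₁, ⟨h₂, h₃⟩, h₄, h₅⟩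
    exact ⟨⟨fun i => by linarith [h₁ i], fun k => by linarith [h₂ k, h₃ k]⟩,
      fun j => by linarith [h₄ j, h₅ j]⟩

theorem IsPolyhedron.isClosed {d : ℕ} {P : Set (Fin d → ℝ)} (hP : IsPolyhedron P) :
    IsClosed P := by
  obtain ⟨m, A, b, rfl⟩ := hP
  exact isClosed_le (by fun_prop) continuous_const

theorem IsPolyhedron.convex {d : ℕ} {P : Set (Fin d → ℝ)} (hP : IsPolyhedron P) :
    Convex ℝ P := by
  obtain ⟨m, A, b, rfl⟩ := hP
  exact (convex_Iic b).linear_preimage A.mulVecLin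

theorem IsPolytope.isCompact {d : ℕ} {P : Set (Fin d → ℝ)} (hP : IsPolytope P) :
    IsCompact P :=
  Metric.isCompact_of_isClosed_isBounded hP.isPolyhedron.isClosed hP.isBounded

/-! ### Facets -/

/-- A facet of a set cut out of a flat by finitely many inequalities `0 ≤ l i x` is the locus where
one of the inequalities is tight. -/
theorem IsFacet.exists_eq_setOf_eq_zero {e : ℕ} {ι : Type} [Fintype ι] {S Q F : Set (Fin e → ℝ)}
    (hS : ∀ p ∈ S, ∀ q ∈ S, ∀ t : ℝ, p + t • (q - p) ∈ S)
    (l : ι → (Fin e → ℝ) →ₗ[ℝ] ℝ) (hQ : Q = {x | x ∈ S ∧ ∀ i, 0 ≤ l i x}) (hF : IsFacet Q F) :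
    ∃ i, {x | x ∈ Q ∧ l i x = 0} = F := by
  classical
  obtain ⟨⟨c, hc⟩, ⟨x₀, hx₀⟩, hdim⟩ := hF
  have hFQ : F ⊆ Q := by rw [hc]; exact fun x hx => hx.1
  have hconst : ∀ x ∈ F, ∀ y ∈ F, c ⬝ᵥ x = c ⬝ᵥ y := by
    intro x hx y hy
    rw [hc] at hx hy
    exact le_antisymm (hy.2 x hx.1) (hx.2 y hy.1)
  have hmemF : ∀ x ∈ Q, c ⬝ᵥ x₀ ≤ c ⬝ᵥ x → x ∈ F := by
    intro x hx h
    rw [hc] at hx₀ ⊢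
    exact ⟨hx, fun y hy => (hx₀.2 y hy).trans h⟩
  have hpos : ∀ x ∈ Q, ∀ i, 0 ≤ l i x := by rw [hQ]; exact fun x hx => hx.2
  -- some inequality is tight on `F` but not on `Q`
  have htight : ∃ i, (∀ x ∈ F, l i x = 0) ∧ ∃ x ∈ Q, l i x ≠ 0 := by
    by_contra! hcon
    -- A point of `F` at which every inequality not identically tight on `Q` is strict: average, one
    -- inequality at a time, with a point of `F` where it is strict.
    have hp : ∀ T : Finset ι, ∃ p ∈ F, ∀ i ∈ T, (∀ x ∈ Q, l i x = 0) ∨ 0 < l i p := by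
      intro T
      induction T using Finset.induction_on with
      | empty => exact ⟨x₀, hx₀, by simp⟩
      | insert i T _ ih =>
        obtain ⟨p, hpF, hp⟩ := ih
        by_cases hi : ∀ x ∈ F, l i x = 0
        · refine ⟨p, hpF, fun j hj => ?_⟩
          rcases Finset.mem_insert.1 hj with rfl | hj
          · exact Or.inl (hcon _ hi)
          · exact hp j hj
        · push Not at hi
          obtain ⟨y, hyF, hy⟩ := hi
          have hl : ∀ j, l j (p + (1 / 2 : ℝ) • (y - p)) = (l j p + l j y) / 2 := by
            intro j
            simp only [map_add, map_smul, map_sub, smul_eq_mul]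
            ring
          refine ⟨p + (1 / 2 : ℝ) • (y - p), hmemF _ ?_ ?_, fun j hj => ?_⟩
          · have h₁ := hFQ hpF
            have h₂ := hFQ hyF
            have h₃ := hpos p h₁
            have h₄ := hpos y h₂
            rw [hQ] at h₁ h₂ ⊢
            refine ⟨hS p h₁.1 y h₂.1 _, fun j => ?_⟩
            rw [hl]
            linarith [h₃ j, h₄ j]
          · simp only [dotProduct_add, dotProduct_smul, dotProduct_sub, smul_eq_mul]
            rw [hconst y hyF p hpF, hconst p hpF x₀ hx₀]
            linarith
          · have h₃ := hpos p (hFQ hpF) j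
            have h₄ := hpos y (hFQ hyF) j
            rw [hl]
            rcases Finset.mem_insert.1 hj with rfl | hj
            · right
              have := lt_of_le_of_ne h₄ hy.symm
              linarith
            · rcases hp j hj with h | h
              · exact Or.inl h
              · right; linarith
    obtain ⟨p, hpF, hp⟩ := hp Finset.univ
    have hQF : Q ⊆ F := by
      intro q hq
      -- Moving from `p` slightly away from `q` (so `t < 0`) stays in `Q`. As `c` is maximal at `p`,
      -- it is at least as large at `q`, so `q ∈ F`. Then `F = Q`, against the dimension of a facet.
      have hev : ∀ᶠ t : ℝ in nhdsWithin 0 (Set.Iio 0), ∀ i, 0 ≤ l i (p + t • (q - p)) := by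
        rw [Filter.eventually_all]
        intro i
        rcases hp i (Finset.mem_univ i) with h | h
        · refine Filter.Eventually.of_forall fun t => ?_
          simp [h q hq, h p (hFQ hpF)]
        · have hcont : Continuous fun t : ℝ => l i p + t * (l i q - l i p) := by fun_prop
          have := hcont.continuousAt.eventually (lt_mem_nhds (b := l i p + 0 * (l i q - l i p))
            (a := 0) (by simpa using h))
          refine (this.filter_mono nhdsWithin_le_nhds).mono fun t ht => ?_
          simpa using ht.le
      obtain ⟨t, ht, ht0⟩ := (hev.and self_mem_nhdsWithin).exists
      have hmem : p + t • (q - p) ∈ Q := by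
        have h₁ := hFQ hpF
        rw [hQ] at h₁ hq ⊢
        exact ⟨hS p h₁.1 q hq.1 t, ht⟩
      have hle : c ⬝ᵥ (p + t • (q - p)) ≤ c ⬝ᵥ p := by
        rw [hc] at hpF
        exact hpF.2 _ hmem
      simp only [dotProduct_add, dotProduct_smul, dotProduct_sub, smul_eq_mul] at hle
      refine hmemF q hq ?_
      rw [hconst x₀ hx₀ p hpF]
      have ht0 : t < 0 := ht0
      nlinarith
    have : F = Q := hFQ.antisymm hQF
    subst this
    omega
  obtain ⟨i, hiF, y, hyQ, hy⟩ := htight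
  refine ⟨i, ?_⟩
  set G := {x | x ∈ Q ∧ l i x = 0}
  have hFG : F ⊆ G := fun x hx => ⟨hFQ hx, hiF x hx⟩
  refine Set.Subset.antisymm ?_ hFG
  have hGker : vectorSpan ℝ G ≤ LinearMap.ker (l i) := by
    rw [vectorSpan_def, Submodule.span_le]
    rintro _ ⟨a, ha, b, hb, rfl⟩
    simp [ha.2, hb.2]
  -- The span of `F` has codimension one in that of `Q`, so `F` and `G` have equal spans; `c` is
  -- constant along the span of `F`, which puts `G` inside `F`.
  have hlt : vectorSpan ℝ G < vectorSpan ℝ Q := by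
    refine lt_of_le_of_ne (vectorSpan_mono ℝ fun x hx => hx.1) fun h => hy ?_
    have h₁ : y -ᵥ x₀ ∈ vectorSpan ℝ G := h ▸ vsub_mem_vectorSpan ℝ hyQ (hFQ hx₀)
    have h₂ := hGker h₁
    simpa [hiF x₀ hx₀] using h₂
  have hle : vectorSpan ℝ F ≤ vectorSpan ℝ G := vectorSpan_mono ℝ hFG
  have h₁ := Submodule.finrank_lt_finrank_of_lt hlt
  have h₂ := Submodule.finrank_mono hle
  rw [polyDim, polyDim, direction_affineSpan, direction_affineSpan] at hdim
  have heq := Submodule.eq_of_le_of_finrank_eq hle (by omega)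
  intro g hg
  have hFker : vectorSpan ℝ F ≤ LinearMap.ker (dotProductBilin ℝ ℝ c) := by
    rw [vectorSpan_def, Submodule.span_le]
    rintro _ ⟨a, ha, b, hb, rfl⟩
    simp [hconst a ha b hb]
  have h₃ : g -ᵥ x₀ ∈ vectorSpan ℝ F := heq ▸ vsub_mem_vectorSpan ℝ hg (hFG hx₀)
  have h₄ := hFker h₃
  simp only [vsub_eq_sub, LinearMap.mem_ker, dotProductBilin_apply_apply, dotProduct_sub] at h₄
  exact hmemF g hg.1 (by linarith)

/-- The number of facets is at most the number of inequalities. -/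
theorem numFacets_le_card {e : ℕ} {ι : Type} [Fintype ι] {S Q : Set (Fin e → ℝ)}
    (hS : ∀ p ∈ S, ∀ q ∈ S, ∀ t : ℝ, p + t • (q - p) ∈ S)
    (l : ι → (Fin e → ℝ) →ₗ[ℝ] ℝ) (hQ : Q = {x | x ∈ S ∧ ∀ i, 0 ≤ l i x}) :
    numFacets Q ≤ Fintype.card ι := by
  have hsub : {F | IsFacet Q F} ⊆ (fun i => {x | x ∈ Q ∧ l i x = 0}) '' Set.univ := by
    intro F hF
    obtain ⟨i, hi⟩ := IsFacet.exists_eq_setOf_eq_zero hS l hQ hF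
    exact ⟨i, trivial, hi⟩
  calc numFacets Q ≤ _ := Set.encard_le_encard hsub
    _ ≤ _ := Set.encard_image_le _ _
    _ = _ := by simp [Set.encard_univ, ENat.card_eq_coe_fintype_card]

/-! ### Support functions -/

theorem IsCompact.bddAbove_image_dotProduct {d : ℕ} {P : Set (Fin d → ℝ)} (hP : IsCompact P)
    (c : Fin d → ℝ) : BddAbove ((fun x => c ⬝ᵥ x) '' P) :=
  (hP.image (by fun_prop)).bddAbove

theorem supportFn_add {d : ℕ} {P Q : Set (Fin d → ℝ)} (hP : IsCompact P) (hQ : IsCompact Q)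
    (hP' : P.Nonempty) (hQ' : Q.Nonempty) (c : Fin d → ℝ) :
    supportFn (P + Q) c = supportFn P c + supportFn Q c := by
  unfold supportFn
  rw [← csSup_add (hP'.image _) (hP.bddAbove_image_dotProduct c) (hQ'.image _)
    (hQ.bddAbove_image_dotProduct c)]
  congr 1
  exact Set.image_add (dotProductBilin ℝ ℝ c)

/-- A point of `P` outside `Q` would be strictly separated from `Q`, and the normal of the
separating hyperplane would violate the inequality. -/
theorem subset_of_supportFn_le {d : ℕ} {P Q : Set (Fin d → ℝ)} (hP : IsCompact P)
    (hQ : IsCompact Q) (hQc : Convex ℝ Q) (hQ' : Q.Nonempty)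
    (h : ∀ c, supportFn P c ≤ supportFn Q c) : P ⊆ Q := by
  intro x hx
  by_contra hxQ
  obtain ⟨f, u, hu, hux⟩ := geometric_hahn_banach_closed_point hQc hQ.isClosed hxQ
  let c : Fin d → ℝ := fun i => f (Pi.single i 1)
  have hf : ∀ y, f y = c ⬝ᵥ y := by
    intro y
    have := LinearMap.pi_apply_eq_sum_univ (f : (Fin d → ℝ) →ₗ[ℝ] ℝ) y
    simp only [ContinuousLinearMap.coe_coe, smul_eq_mul] at this
    rw [this]
    refine Finset.sum_congr rfl fun i _ => ?_
    rw [mul_comm]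
    congr 2
    ext j
    simp [Pi.single_apply, eq_comm]
  have h₁ : c ⬝ᵥ x ≤ supportFn P c := le_csSup (hP.bddAbove_image_dotProduct c) ⟨x, hx, rfl⟩
  have h₂ : supportFn Q c ≤ u := by
    refine csSup_le (hQ'.image _) ?_
    rintro _ ⟨y, hy, rfl⟩
    have := hu y hy
    rw [hf] at this
    exact this.le
  rw [hf] at hux
  linarith [h c]

theorem IsPolytope.add_eq_of_supportFn {d : ℕ} {P Q R : Set (Fin d → ℝ)} (hP : IsPolytope P)
    (hQ : IsPolytope Q) (hR : IsPolytope R)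
    (h : ∀ c, supportFn P c + supportFn Q c = supportFn R c) : P + Q = R := by
  have hPQ : ∀ c, supportFn (P + Q) c = supportFn R c := fun c => by
    rw [supportFn_add hP.isCompact hQ.isCompact hP.nonempty hQ.nonempty, h]
  have hc := hP.isCompact.add hQ.isCompact
  exact (subset_of_supportFn_le hc hR.isCompact hR.isPolyhedron.convex hR.nonempty
    fun c => (hPQ c).le).antisymm
    (subset_of_supportFn_le hR.isCompact hc (hP.isPolyhedron.convex.add hQ.isPolyhedron.convex)
      (hP.nonempty.add hQ.nonempty) fun c => (hPQ c).ge)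

/-! ### Extended formulations in standard form -/

/-- The linear image of a bounded nonempty set `{y | 0 ≤ y, E y = q}` is a polytope. -/
theorem isPolytope_image_standardForm {d : ℕ} {ι κ : Type} [Fintype ι] [Fintype κ]
    (E : κ → ι → ℝ) (q : κ → ℝ) (M : Fin d → ι → ℝ) {Q : Set (ι → ℝ)}
    (hQ : Q = {y | (∀ i, 0 ≤ y i) ∧ ∀ k, E k ⬝ᵥ y = q k}) (hne : Q.Nonempty)
    (C : ι → ℝ) (hC : ∀ y ∈ Q, ∀ i, y i ≤ C i) :
    IsPolytope ((fun y : ι → ℝ => fun j => M j ⬝ᵥ y) '' Q) := by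
  have hQC : Q ⊆ Set.Icc 0 C := fun y hy => ⟨by rw [hQ] at hy; exact hy.1, hC y hy⟩
  refine ⟨?_, ?_, hne.image _⟩
  · rw [hQ]
    exact isPolyhedron_image_standardForm E q M
  · refine Bornology.IsBounded.subset ?_ (Set.image_mono hQC)
    exact (isCompact_Icc.image (by fun_prop)).isBounded

/-- The extension complexity of the linear image of a bounded nonempty set `{y | 0 ≤ y, E y = q}` is
at most the number of variables. -/
theorem xc_image_standardForm_le {d : ℕ} {ι κ : Type} [Fintype ι] [Fintype κ]
    (E : κ → ι → ℝ) (q : κ → ℝ) (M : Fin d → ι → ℝ) {Q : Set (ι → ℝ)}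
    (hQ : Q = {y | (∀ i, 0 ≤ y i) ∧ ∀ k, E k ⬝ᵥ y = q k}) (hne : Q.Nonempty)
    (C : ι → ℝ) (hC : ∀ y ∈ Q, ∀ i, y i ≤ C i) :
    xc ((fun y : ι → ℝ => fun j => M j ⬝ᵥ y) '' Q) ≤ Fintype.card ι := by
  classical
  let e := Fintype.equivFin ι
  let n := Fintype.card ι
  -- An extended formulation must live in dimension at least `d`. The variables are padded with `d`
  -- coordinates fixed at zero by equations, which adds no inequality.
  let ρ : (Fin (n + d) → ℝ) →ₗ[ℝ] (ι → ℝ) :=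
    LinearMap.funLeft ℝ ℝ fun i => Fin.castAdd d (e i)
  let S : Set (Fin (n + d) → ℝ) := {x | (∀ k, E k ⬝ᵥ ρ x = q k) ∧ ∀ j, x (Fin.natAdd n j) = 0}
  let Q' : Set (Fin (n + d) → ℝ) := {x | x ∈ S ∧ ∀ i, 0 ≤ ρ x i}
  let ext : (ι → ℝ) → Fin (n + d) → ℝ := fun y => Fin.append (y ∘ e.symm) 0
  have hρ : ∀ y, ρ (ext y) = y := by
    intro y
    ext i
    simp [ρ, ext, LinearMap.funLeft_apply, n]
  have hρQ : ∀ x ∈ Q', ρ x ∈ Q := by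
    intro x hx
    rw [hQ]
    exact ⟨hx.2, hx.1.1⟩
  have hextQ : ∀ y ∈ Q, ext y ∈ Q' := by
    intro y hy
    rw [hQ] at hy
    refine ⟨⟨fun k => ?_, fun j => ?_⟩, fun i => ?_⟩
    · rw [hρ]; exact hy.2 k
    · simp [ext]
    · rw [hρ]; exact hy.1 i
  have hext : ∀ x ∈ Q', ext (ρ x) = x := by
    intro x hx
    ext j
    refine Fin.addCases (fun j => ?_) (fun j => ?_) j
    · simp [ext, ρ, LinearMap.funLeft_apply]
    · simp [ext, hx.1.2 j]
  let A : (Fin (n + d) → ℝ) →ₗ[ℝ] (Fin d → ℝ) := (Matrix.of M).mulVecLin ∘ₗ ρ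
  have himage : A '' Q' = (fun y : ι → ℝ => fun j => M j ⬝ᵥ y) '' Q := by
    ext x
    constructor
    · rintro ⟨y, hy, rfl⟩
      exact ⟨ρ y, hρQ y hy, rfl⟩
    · rintro ⟨y, hy, rfl⟩
      refine ⟨ext y, hextQ y hy, ?_⟩
      change Matrix.mulVec (Matrix.of M) (ρ (ext y)) = _
      rw [hρ]
      rfl
  have hpoly : IsPolytope Q' := by
    let M' : Fin (n + d) → ι → ℝ := Fin.append (fun i => Pi.single (e.symm i) 1) 0
    have hM' : (fun y : ι → ℝ => fun j => M' j ⬝ᵥ y) = ext := by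
      ext y j
      refine Fin.addCases (fun j => ?_) (fun j => ?_) j <;> simp [M', ext]
    have hQ' : ext '' Q = Q' := by
      ext x
      exact ⟨by rintro ⟨y, hy, rfl⟩; exact hextQ y hy, fun hx => ⟨ρ x, hρQ x hx, hext x hx⟩⟩
    rw [← hQ', ← hM']
    exact isPolytope_image_standardForm E q M' hQ hne C hC
  have hfacets : numFacets Q' ≤ Fintype.card ι := by
    refine numFacets_le_card (S := S) ?_ (fun i => (LinearMap.proj i) ∘ₗ ρ) rfl
    rintro a ⟨ha₁, ha₂⟩ b ⟨hb₁, hb₂⟩ t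
    refine ⟨fun k => ?_, fun j => ?_⟩
    · simp [dotProduct_add, dotProduct_sub, ha₁ k, hb₁ k]
    · simp [ha₂ j, hb₂ j]
  refine le_trans ?_ hfacets
  exact iInf_le_of_le _ (iInf_le_of_le Q' (iInf_le_of_le A.toAffineMap
    (iInf_le _ ⟨Nat.le_add_left _ _, hpoly, himage⟩)))

/-! ### Monotone max-linear systems -/

/-- The matrix `f` is strictly triangular for `ρ`, so the system is solved by recursion. It is used
along the arcs for the subtrahends and against them for dual solutions. -/
theorem exists_eq_add_sum_of_wellFounded {V : Type} [Fintype V] {ρ : V → V → Prop}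
    (hρ : WellFounded ρ) (f : V → V → ℝ) (hf : ∀ u v, f u v ≠ 0 → ρ v u) (l : V → ℝ) :
    ∃ φ : V → ℝ, ∀ u, φ u = l u + ∑ v, f u v * φ v := by
  classical
  refine ⟨hρ.fix fun u φ => l u + ∑ v, if h : ρ v u then f u v * φ v h else 0, fun u => ?_⟩
  rw [WellFounded.fix_eq]
  congr 1
  refine Finset.sum_congr rfl fun v _ => ?_
  split_ifs with h
  · rfl
  · have : f u v = 0 := by
      by_contra h'
      exact h (hf u v h')
    simp [this]

/-- Let `p v` be the maximum of two nonnegative combinations of preceding functions `p u`, plus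
linear functions. Then every nonnegative combination of the `p v` is the support function of a
polytope with extension complexity at most twice the number of functions. -/
theorem exists_polytope_of_monotone_system {d : ℕ} {V : Type} [Fintype V] {r : V → V → Prop}
    (hr : WellFounded fun u v => r v u) (w : V → Fin 2 → V → ℝ) (hw : ∀ v i u, 0 ≤ w v i u)
    (hwr : ∀ v i u, w v i u ≠ 0 → r u v) (a : V → Fin 2 → Fin d → ℝ)
    (p : V → (Fin d → ℝ) → ℝ)
    (hp_le : ∀ v c i, ∑ u, w v i u * p u c + a v i ⬝ᵥ c ≤ p v c)
    (hp_eq : ∀ v c, ∃ i, p v c = ∑ u, w v i u * p u c + a v i ⬝ᵥ c)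
    (l : V → ℝ) (hl : ∀ v, 0 ≤ l v) :
    ∃ R : Set (Fin d → ℝ), IsPolytope R ∧ xc R ≤ 2 * Fintype.card V ∧
      ∀ c, supportFn R c = ∑ v, l v * p v c := by
  classical
  -- The dual program: a flow with one variable per unit and argument, where `l u` plus the weighted
  -- flow from later units equals the total at `u`.
  let E : V → V × Fin 2 → ℝ := fun u q => (if q.1 = u then 1 else 0) - w q.1 q.2 u
  let M : Fin d → V × Fin 2 → ℝ := fun j q => a q.1 q.2 j
  let Q : Set (V × Fin 2 → ℝ) := {y | (∀ i, 0 ≤ y i) ∧ ∀ k, E k ⬝ᵥ y = l k}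
  have hE : ∀ u (y : V × Fin 2 → ℝ),
      E u ⬝ᵥ y = ∑ i, y (u, i) - ∑ q : V × Fin 2, w q.1 q.2 u * y q := by
    intro u y
    simp only [E, dotProduct, sub_mul, Finset.sum_sub_distrib]
    congr 1
    rw [Fintype.sum_prod_type_right]
    simp
  have hobj : ∀ c (y : V × Fin 2 → ℝ), c ⬝ᵥ (fun j => M j ⬝ᵥ y) =
      ∑ q : V × Fin 2, y q * (a q.1 q.2 ⬝ᵥ c) := by
    intro c y
    simp only [M, dotProduct, Finset.mul_sum]
    rw [Finset.sum_comm]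
    exact Finset.sum_congr rfl fun q _ => Finset.sum_congr rfl fun j _ => by ring
  -- The duality gap is a sum of variables times slacks: weak duality is immediate, and equality
  -- holds when `y` is supported on tight arguments.
  have hdual : ∀ c, ∀ y ∈ Q, ∑ v, l v * p v c =
      ∑ q : V × Fin 2, y q * (p q.1 c - ∑ u, w q.1 q.2 u * p u c) := by
    intro c y hy
    have h₁ : ∀ v, l v * p v c = ∑ q : V × Fin 2, E v q * y q * p v c := fun v => by
      rw [← hy.2 v, dotProduct, Finset.sum_mul]
    simp only [h₁]
    rw [Finset.sum_comm]
    refine Finset.sum_congr rfl fun q _ => ?_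
    simp only [E, sub_mul, Finset.sum_sub_distrib, mul_sub]
    congr 1
    · simp
    · rw [Finset.mul_sum]
      exact Finset.sum_congr rfl fun u _ => by ring
  have hweak : ∀ c, ∀ y ∈ Q, c ⬝ᵥ (fun j => M j ⬝ᵥ y) ≤ ∑ v, l v * p v c := by
    intro c y hy
    rw [hobj, hdual c y hy]
    refine Finset.sum_le_sum fun q _ => mul_le_mul_of_nonneg_left ?_ (hy.1 q)
    linarith [hp_le q.1 c q.2]
  have hstrong : ∀ c, ∃ y ∈ Q, c ⬝ᵥ (fun j => M j ⬝ᵥ y) = ∑ v, l v * p v c := by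
    intro c
    -- Send all flow of `v` through an argument `σ v` attaining the maximum at `c`; complementary
    -- slackness then holds.
    choose σ hσ using fun v => hp_eq v c
    obtain ⟨φ, hφ⟩ := exists_eq_add_sum_of_wellFounded hr (fun u v => w v (σ v) u)
      (fun u v h => hwr v _ u h) l
    have hφ0 : ∀ u, 0 ≤ φ u := by
      intro u
      induction u using hr.induction with
      | _ u ih =>
        rw [hφ]
        refine add_nonneg (hl u) (Finset.sum_nonneg fun v _ => ?_)
        by_cases h : w v (σ v) u = 0
        · simp [h]
        · exact mul_nonneg (hw _ _ _) (ih v (hwr _ _ _ h))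
    let y : V × Fin 2 → ℝ := fun q => if q.2 = σ q.1 then φ q.1 else 0
    have hy : y ∈ Q := by
      refine ⟨fun q => ?_, fun u => ?_⟩
      · simp only [y]
        split_ifs
        exacts [hφ0 _, le_rfl]
      · rw [hE]
        have h₁ : ∑ i, y (u, i) = φ u := by simp [y]
        have h₂ : ∑ q : V × Fin 2, w q.1 q.2 u * y q = ∑ v, w v (σ v) u * φ v := by
          rw [Fintype.sum_prod_type]
          refine Finset.sum_congr rfl fun v _ => ?_
          simp [y]
        rw [h₁, h₂]
        linarith [hφ u]
    refine ⟨y, hy, ?_⟩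
    rw [hobj, hdual c y hy]
    refine Finset.sum_congr rfl fun q _ => ?_
    by_cases h : q.2 = σ q.1
    · have := hσ q.1
      rw [← h] at this
      rw [this]
      ring
    · simp [y, h]
  -- Flow at `u` is bounded in terms of flow at later units, so boundedness propagates backwards
  -- through the well-founded order.
  have hbound : ∀ u, ∃ C, ∀ y ∈ Q, ∀ i, y (u, i) ≤ C := by
    intro u
    induction u using hr.induction with
    | _ u ih =>
      have h : ∀ q : V × Fin 2, ∃ C, ∀ y ∈ Q, w q.1 q.2 u * y q ≤ C := by
        rintro ⟨v, i⟩
        by_cases h : w v i u = 0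
        · exact ⟨0, fun y _ => by simp [h]⟩
        · obtain ⟨C, hC⟩ := ih v (hwr _ _ _ h)
          exact ⟨w v i u * C, fun y hy => mul_le_mul_of_nonneg_left (hC y hy i) (hw _ _ _)⟩
      choose C hC using h
      refine ⟨l u + ∑ q, C q, fun y hy i => ?_⟩
      have h₁ : y (u, i) ≤ ∑ i, y (u, i) :=
        Finset.single_le_sum (f := fun i => y (u, i)) (fun i _ => hy.1 _) (Finset.mem_univ i)
      have h₂ := hy.2 u
      rw [hE] at h₂
      have h₃ : ∑ q : V × Fin 2, w q.1 q.2 u * y q ≤ ∑ q, C q :=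
        Finset.sum_le_sum fun q _ => hC q y hy
      linarith
  choose C hC using hbound
  obtain ⟨y₀, hy₀, -⟩ := hstrong 0
  have hQC : ∀ y ∈ Q, ∀ q : V × Fin 2, y q ≤ C q.1 := fun y hy q => hC q.1 y hy q.2
  refine ⟨_, isPolytope_image_standardForm E l M (Q := Q) rfl ⟨y₀, hy₀⟩ _ hQC,
    (xc_image_standardForm_le E l M (Q := Q) rfl ⟨y₀, hy₀⟩ _ hQC).trans_eq
      (by simp [mul_comm]), fun c => ?_⟩
  refine IsGreatest.csSup_eq ⟨?_, ?_⟩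
  · obtain ⟨y, hy, h⟩ := hstrong c
    exact ⟨_, ⟨y, hy, rfl⟩, h⟩
  · rintro _ ⟨_, ⟨y, hy, rfl⟩, rfl⟩
    exact hweak c y hy

/-! ### Networks as differences of monotone systems -/

namespace MaxoutNetwork

variable {d s : ℕ} (N : MaxoutNetwork 2 d s)

open Classical in
/-- The weight of an arc into a maxout unit, extended by zero to pairs that are not arcs. -/
noncomputable def arcWeight (i : Fin 2) (u : Fin d ⊕ Fin s) (v : Fin s) : ℝ :=
  if N.Arc u (Sum.inr v) then N.weight i u (Sum.inr v) else 0

theorem arc_of_arcWeight_ne_zero {i : Fin 2} {u : Fin d ⊕ Fin s} {v : Fin s}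
    (h : N.arcWeight i u v ≠ 0) : N.Arc u (Sum.inr v) := by
  by_contra h'
  exact h (if_neg h')

/-- The `i`-th argument of the maximum computed by the unit `v`. -/
noncomputable def preactivation (x : Fin d → ℝ) (v : Fin s) (i : Fin 2) : ℝ :=
  ∑ u, N.arcWeight i (Sum.inr u) v * N.value x (Sum.inr u) +
    (fun j => N.arcWeight i (Sum.inl j) v) ⬝ᵥ x

theorem value_inr_eq_iSup_preactivation (x : Fin d → ℝ) (v : Fin s) :
    N.value x (Sum.inr v) = ⨆ i, N.preactivation x v i := by
  classical
  rw [value_inr]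
  congr 1
  ext i
  have h : ∑ u : {u // N.Arc u (Sum.inr v)}, N.weight i u (Sum.inr v) * N.value x u =
      ∑ u, N.arcWeight i u v * N.value x u := by
    simp only [arcWeight, ite_mul, zero_mul]
    rw [← Finset.sum_filter]
    exact (Finset.sum_subtype (Finset.univ.filter fun u => N.Arc u (Sum.inr v)) (by simp)
      fun u => N.weight i u (Sum.inr v) * N.value x u).symm
  rw [h, Fintype.sum_sum_type, preactivation, add_comm]
  simp [dotProduct, value_inl]

theorem preactivation_le_value (x : Fin d → ℝ) (v : Fin s) (i : Fin 2) :
    N.preactivation x v i ≤ N.value x (Sum.inr v) := by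
  rw [value_inr_eq_iSup_preactivation]
  exact le_ciSup (Set.finite_range _).bddAbove i

theorem exists_value_eq_preactivation (x : Fin d → ℝ) (v : Fin s) :
    ∃ i, N.value x (Sum.inr v) = N.preactivation x v i := by
  rw [value_inr_eq_iSup_preactivation]
  obtain ⟨i, hi⟩ := exists_eq_ciSup_of_finite (f := N.preactivation x v)
  exact ⟨i, hi.symm⟩

/-- The strict order on the maxout units generated by the arcs. -/
def Precedes (u v : Fin s) : Prop := Relation.TransGen N.Arc (Sum.inr u) (Sum.inr v)

theorem wellFounded_precedes : WellFounded N.Precedes := by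
  have : Std.Irrefl N.Precedes := ⟨fun v => N.acyclic _⟩
  have : IsTrans _ N.Precedes := ⟨fun _ _ _ h h' => Relation.TransGen.trans h h'⟩
  exact Finite.wellFounded_of_trans_of_irrefl _

theorem wellFounded_precedes_swap : WellFounded fun u v => N.Precedes v u := by
  have : Std.Irrefl fun u v => N.Precedes v u := ⟨fun v => N.acyclic _⟩
  have : IsTrans _ fun u v => N.Precedes v u := ⟨fun _ _ _ h h' => Relation.TransGen.trans h' h⟩
  exact Finite.wellFounded_of_trans_of_irrefl _

theorem precedes_of_arcWeight_ne_zero {i : Fin 2} {u v : Fin s}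
    (h : N.arcWeight i (Sum.inr u) v ≠ 0) : N.Precedes u v :=
  Relation.TransGen.single (N.arc_of_arcWeight_ne_zero h)

/-- There are functions `n v` such that, writing `z v = p v - n v`, the function `n v` is the sum of
the subtrahends of the two preactivations obtained by splitting the weights into positive and
negative parts. -/
theorem exists_subtrahend : ∃ n : Fin s → (Fin d → ℝ) → ℝ, ∀ v x,
    n v x = ∑ i, ∑ u, ((N.arcWeight i (Sum.inr u) v)⁻ * (N.value x (Sum.inr u) + n u x) +
      (N.arcWeight i (Sum.inr u) v)⁺ * n u x) := by
  -- Collecting the coefficients of `n u` gives `W⁻ + W⁺ = |W|`.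
  have h := fun x => exists_eq_add_sum_of_wellFounded N.wellFounded_precedes
    (fun v u => ∑ i, |N.arcWeight i (Sum.inr u) v|)
    (fun v u h => by
      obtain ⟨i, -, hi⟩ := Finset.exists_ne_zero_of_sum_ne_zero h
      exact N.precedes_of_arcWeight_ne_zero (abs_ne_zero.1 hi))
    (fun v => ∑ i, ∑ u, (N.arcWeight i (Sum.inr u) v)⁻ * N.value x (Sum.inr u))
  choose φ hφ using h
  refine ⟨fun v x => φ x v, fun v x => ?_⟩
  beta_reduce
  rw [hφ x v]
  simp only [Finset.sum_mul]
  rw [Finset.sum_comm (f := fun u i => |N.arcWeight i (Sum.inr u) v| * φ x u),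
    ← Finset.sum_add_distrib]
  refine Finset.sum_congr rfl fun i _ => ?_
  rw [← Finset.sum_add_distrib]
  refine Finset.sum_congr rfl fun u _ => ?_
  rw [← posPart_add_negPart]
  ring

/-- The function computed by a network with `s` units is a difference of support functions of
polytopes of extension complexity at most `2 * s`. -/
theorem exists_polytopes_toFun_eq_sub : ∃ Q R : Set (Fin d → ℝ), IsPolytope Q ∧ IsPolytope R ∧
    xc Q ≤ 2 * s ∧ xc R ≤ 2 * s ∧ ∀ x, N.toFun x + supportFn Q x = supportFn R x := by
  classical
  obtain ⟨n, hn⟩ := N.exists_subtrahend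
  let W : Fin 2 → Fin s → Fin s → ℝ := fun i u v => N.arcWeight i (Sum.inr u) v
  have hW : ∀ i u v, W i u v ≠ 0 → N.Precedes u v := fun i u v =>
    N.precedes_of_arcWeight_ne_zero
  let p : Fin s → (Fin d → ℝ) → ℝ := fun v x => N.value x (Sum.inr v) + n v x
  have hn' : ∀ v x, n v x = ∑ i, ∑ u, ((W i u v)⁻ * p u x + (W i u v)⁺ * n u x) := hn
  have hμ : ∀ v, ∃ μ : Fin s → ℝ, (∀ k, 0 ≤ μ k) ∧ (∀ k, μ k ≠ 0 → N.Precedes k v) ∧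
      ∀ x, n v x = ∑ k, μ k * p k x := by
    intro v
    induction v using N.wellFounded_precedes.induction with
    | _ v ih =>
      have h : ∀ i u, ∃ μ : Fin s → ℝ, (∀ k, 0 ≤ μ k) ∧ (∀ k, μ k ≠ 0 → N.Precedes k v) ∧
          ∀ x, (W i u v)⁻ * p u x + (W i u v)⁺ * n u x = ∑ k, μ k * p k x := by
        intro i u
        by_cases hu : W i u v = 0
        · exact ⟨0, fun _ => le_rfl, fun k hk => absurd rfl hk, fun x => by simp [hu]⟩
        · obtain ⟨μ, h₁, h₂, h₃⟩ := ih u (hW i u v hu)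
          refine ⟨fun k => (if k = u then (W i u v)⁻ else 0) + (W i u v)⁺ * μ k,
            fun k => ?_, fun k hk => ?_, fun x => ?_⟩
          · refine add_nonneg ?_ (mul_nonneg (posPart_nonneg _) (h₁ k))
            split_ifs
            exacts [negPart_nonneg _, le_rfl]
          · by_cases hk' : k = u
            · exact hk' ▸ hW i u v hu
            · refine Relation.TransGen.trans (h₂ k fun h => hk ?_) (hW i u v hu)
              simp [hk', h]
          · simp only [add_mul, Finset.sum_add_distrib, ite_mul, zero_mul, Finset.sum_ite_eq',
              Finset.mem_univ, if_true, h₃, Finset.mul_sum, mul_assoc]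
      choose μ h₁ h₂ h₃ using h
      refine ⟨fun k => ∑ i, ∑ u, μ i u k, fun k => Finset.sum_nonneg fun i _ =>
        Finset.sum_nonneg fun u _ => h₁ i u k, fun k hk => ?_, fun x => ?_⟩
      · obtain ⟨i, -, hi⟩ := Finset.exists_ne_zero_of_sum_ne_zero hk
        obtain ⟨u, -, hu⟩ := Finset.exists_ne_zero_of_sum_ne_zero hi
        exact h₂ i u k hu
      · rw [hn']
        simp only [h₃, Finset.sum_mul]
        rw [Finset.sum_comm (s := Finset.univ (α := Fin s)) (t := Finset.univ (α := Fin 2))]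
        refine Finset.sum_congr rfl fun i _ => Finset.sum_comm
  choose μ hμ0 hμW hμn using hμ
  -- Coefficients of argument `i` after adding `n v`: its own minuend plus the subtrahend of the
  -- other argument `i.rev`, with each `n u` expanded through `μ u`.
  let w : Fin s → Fin 2 → Fin s → ℝ := fun v i k =>
    ((W i k v)⁺ + (W i.rev k v)⁻) + ∑ u, ((W i u v)⁻ + (W i.rev u v)⁺) * μ u k
  let a : Fin s → Fin 2 → Fin d → ℝ := fun v i j => N.arcWeight i (Sum.inl j) v
  have hw : ∀ v i k, 0 ≤ w v i k := fun v i k =>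
    add_nonneg (add_nonneg (posPart_nonneg _) (negPart_nonneg _)) (Finset.sum_nonneg fun u _ =>
      mul_nonneg (add_nonneg (negPart_nonneg _) (posPart_nonneg _)) (hμ0 u k))
  have hwr : ∀ v i k, w v i k ≠ 0 → N.Precedes k v := by
    intro v i k h
    by_contra hk
    have h₀ : ∀ i, W i k v = 0 := fun i => by
      by_contra h'
      exact hk (hW i k v h')
    refine h ?_
    simp only [w, h₀, posPart_zero, negPart_zero, add_zero, zero_add]
    refine Finset.sum_eq_zero fun u _ => ?_
    by_cases hu : N.Precedes u v
    · have : μ u k = 0 := by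
        by_contra h'
        exact hk (Relation.TransGen.trans (hμW u k h') hu)
      simp [this]
    · have h₀ : ∀ i, W i u v = 0 := fun i => by
        by_contra h'
        exact hu (hW i u v h')
      simp [h₀]
  have hpre : ∀ v x i, ∑ k, w v i k * p k x + a v i ⬝ᵥ x = N.preactivation x v i + n v x := by
    intro v x i
    have h₁ : ∑ k, w v i k * p k x = ∑ u, (((W i u v)⁺ + (W i.rev u v)⁻) * p u x +
        ((W i u v)⁻ + (W i.rev u v)⁺) * n u x) := by
      simp only [w, add_mul _ (∑ u, _), Finset.sum_add_distrib]
      congr 1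
      simp only [hμn, Finset.sum_mul, Finset.mul_sum]
      rw [Finset.sum_comm]
      exact Finset.sum_congr rfl fun u _ => Finset.sum_congr rfl fun k _ => by ring
    have h₂ : n v x = ∑ u, ((W i u v)⁻ * p u x + (W i u v)⁺ * n u x) +
        ∑ u, ((W i.rev u v)⁻ * p u x + (W i.rev u v)⁺ * n u x) := by
      rw [hn', Fin.sum_univ_two]
      fin_cases i
      · rfl
      · exact add_comm _ _
    rw [h₁, h₂, preactivation, ← sub_eq_zero]
    have h₃ : ∑ u, N.arcWeight i (Sum.inr u) v * N.value x (Sum.inr u) =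
        ∑ u, ((W i u v)⁺ - (W i u v)⁻) * (p u x - n u x) :=
      Finset.sum_congr rfl fun u _ => by simp only [posPart_sub_negPart, p, W]; ring
    rw [h₃]
    have h₄ : ∑ u, (((W i u v)⁺ + (W i.rev u v)⁻) * p u x +
        ((W i u v)⁻ + (W i.rev u v)⁺) * n u x) =
        ∑ u, ((W i u v)⁺ - (W i u v)⁻) * (p u x - n u x) +
        (∑ u, ((W i u v)⁻ * p u x + (W i u v)⁺ * n u x) +
        ∑ u, ((W i.rev u v)⁻ * p u x + (W i.rev u v)⁺ * n u x)) := by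
      rw [← Finset.sum_add_distrib, ← Finset.sum_add_distrib]
      exact Finset.sum_congr rfl fun u _ => by ring
    rw [h₄]
    simp only [a]
    ring
  have key := exists_polytope_of_monotone_system N.wellFounded_precedes_swap w hw hwr a p
    (fun v x i => by
      rw [hpre]
      exact add_le_add_left (N.preactivation_le_value x v i) _)
    (fun v x => by
      obtain ⟨i, hi⟩ := N.exists_value_eq_preactivation x v
      exact ⟨i, by rw [hpre, ← hi]⟩)
  -- The coefficients `μ N.output` yield `n` at the output, and the unit vector yields `p` there.
  obtain ⟨Q, hQ, hQxc, hQs⟩ := key (μ N.output) (hμ0 _)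
  obtain ⟨R, hR, hRxc, hRs⟩ := key (Pi.single N.output 1) fun v =>
    (Pi.single_nonneg.2 zero_le_one : (0 : Fin s → ℝ) ≤ Pi.single N.output 1) v
  rw [Fintype.card_fin] at hQxc hRxc
  refine ⟨Q, R, hQ, hR, hQxc, hRxc, fun x => ?_⟩
  rw [hQs, hRs, ← hμn]
  simp [Pi.single_apply, p, toFun]

end MaxoutNetwork

theorem mainTheorem1 {d : ℕ} (P : Set (Fin d → ℝ)) (hP : IsPolytope P) :
    vxc P ≤ 4 * nnc P := by
  have key : ∀ (s : ℕ) (N : MaxoutNetwork 2 d s), N.toFun = supportFn P → vxc P ≤ 4 * s := by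
    intro s N hN
    obtain ⟨Q, R, hQ, hR, hQxc, hRxc, h⟩ := N.exists_polytopes_toFun_eq_sub
    rw [hN] at h
    calc vxc P ≤ xc Q + xc R := iInf_le_of_le Q (iInf_le_of_le R
          (iInf_le _ ⟨hQ, hR, hP.add_eq_of_supportFn hQ hR h⟩))
      _ ≤ 2 * s + 2 * s := add_le_add hQxc hRxc
      _ = 4 * s := by rw [← add_mul]; norm_num
  by_cases htop : nnc P = ⊤
  · rw [htop, ENat.mul_top (by norm_num)]
    exact le_top
  · obtain ⟨m, hm⟩ := ENat.ne_top_iff_exists.1 htop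
    -- A strict bound above the infimum extracts an actual network, of size at most `m` by
    -- integrality.
    have hlt : nnc P < (m + 1 : ℕ) := by
      rw [← hm]
      exact_mod_cast Nat.lt_succ_self m
    simp only [nnc, iInf_lt_iff] at hlt
    obtain ⟨s, N, hN, hs⟩ := hlt
    have hsm : s ≤ m := Nat.lt_succ_iff.1 (by exact_mod_cast hs)
    rw [← hm]
    exact (key s N hN).trans (by gcongr)
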